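/- A triple of vertices of a finite simple graph $G$ is a frustrated triangle if it induces an odd number of edges (one or three). Let $f(G)$ be the number of frustrated triangles of $G$, and for $n\in\mathbb N$ let $F_n=\{f(G): G \text{ is a graph on } n \text{ vertices}\}\subseteq\{0,1,\dots,\binom n3\}$. (i) There are constants $C>0$ and $N$ such that for every even $n\ge N$: the set $F_n$ contains every even integer in the interval $$\left[\,n^{3/2}+C n^{5/4},\ \binom n3-\left(n^{3/2}+C n^{5/4}\right)\right];$$ and this is best possible up to the second-order term: there are even integers $m,m'\in[0,\binom n3]\setminus F_n$ with $$\left|m-n^{3/2}\right|\le C n^{5/4}\quad\text{and}\quad \left|m'-\left(\binom n3-n^{3/2}\right)\right|\le C n^{5/4}.$$ (ii) There are constants $C>0$ and $N$ such that for every odd $n\ge N$: the set $F_n$ contains every integer in the interval $$\left[\,\sqrt2\,n^{3/2}+C n^{5/4},\ \binom n3-\left(\sqrt2\,n^{3/2}+C n^{5/4}\right)\right];$$ and this is best possible up to the second-order term: there are integers $m,m'\in[0,\binom n3]\setminus F_n$ with $$\left|m-\sqrt2\,n^{3/2}\right|\le C n^{5/4}\quad\text{and}\quad \left|m'-\left(\binom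 n3-\sqrt2\,n^{3/2}\right)\right|\le C n^{5/4}.$$ -/

import Mathlib

/-- The frustrated triangles of a graph `G`: the triples (three-element sets) of vertices that
induce an odd number of edges. -/
def frustratedTriangles {V : Type*} (G : SimpleGraph V) : Set (Finset V) :=
  {T | T.card = 3 ∧ Odd (G.induce (T : Set V)).edgeSet.ncard}

/-- `frustratedCount G` is `f(G)`, the number of frustrated triangles of a finite graph `G`. -/
noncomputable def frustratedCount {V : Type*} [Finite V] (G : SimpleGraph V) : ℕ :=
  (frustratedTriangles G).ncard

/-- `frustratedCounts n` is `F_n`, the set of the values `f(G)` over all graphs `G` on `n`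
vertices. -/
def frustratedCounts (n : ℕ) : Set ℕ :=
  {m | ∃ G : SimpleGraph (Fin n), frustratedCount G = m}

/-! Write e for the number of edges. Complementing `G` complements its set of frustrated triples, so
everything reduces to counts at most half of C(n,3). Each edge lies in n - 2 triples, whence f ≤ e(n
- 2) and f ≡ e(n - 2) mod 2; any two edges share at most one triple, whence f ≥ e(n - 1 - e).

Gaps. Frustration is invariant under switching. Averaging over the switchings that isolate one
vertex, a representative with n·e ≤ 3f exists (`exists_card_edgeFinset_le`), so a small count comes
from a graph with few edges, where the lower bound is effective. The values for e = t and e = t + 1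
are then separated while t² is below about n. For odd n the parity of f fixes that of e, so the
competitors are t and t + 2, separated while t² is below about 2n. These thresholds give n^(3/2) and
√2·n^(3/2) (`notMem_frustratedCounts_of_gap`).

Realization. Counts add over graphs with disjoint supports. A star with k leaves contributes k(n -
2) - k(k - 1), so a star forest with t edges has count t(n - 2) - 2p, where p is the sum of the C(k,
2). Splitting p greedily into triangular numbers reaches every required p with t about √(2p) +
O(p^(1/4)) (`StarForestRealizable.of_le`). A graph on the remaining vertices brings the target
within one window of length n - 2, and the star forest hits it exactly. For even n this needs 2p <
n; for odd n a parity correction costs one more edge and doubles the range of p, which produces the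
√2. -/

open Classical in
/-- The frustrated triangles as a finset. -/
noncomputable def frustratedFinset {V : Type*} [Fintype V] (G : SimpleGraph V) :
    Finset (Finset V) :=
  {T | T ∈ frustratedTriangles G}

/-! ### Frustrated triples: parity, complement, edge bounds and switching. -/

section Basic

open Finset Classical

variable {V : Type*} {G H : SimpleGraph V}

lemma exists_triple_of_mem {T : Finset V} (hT : T ∈ frustratedTriangles G) :
    ∃ a b c, a ≠ b ∧ a ≠ c ∧ b ≠ c ∧ T = {a, b, c} :=
  card_eq_three.1 hT.1

lemma insert_triple_injOn {u v : V} :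
    Set.InjOn (fun w ↦ ({u, v, w} : Finset V)) {w | w ≠ u ∧ w ≠ v} := by
  intro w hw x hx h
  have : w ∈ ({u, v, x} : Finset V) := by
    have h' : ({u, v, w} : Finset V) = {u, v, x} := h
    rw [← h']; simp
  simp only [mem_insert, mem_singleton] at this
  rcases this with h | h | h
  · exact absurd h hw.1
  · exact absurd h hw.2
  · exact h

variable [Fintype V]

lemma mem_frustratedFinset {T : Finset V} :
    T ∈ frustratedFinset G ↔ T ∈ frustratedTriangles G := by
  simp [frustratedFinset]

lemma frustratedCount_eq_card (G : SimpleGraph V) :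
    frustratedCount G = #(frustratedFinset G) := by
  rw [frustratedCount, ← Set.ncard_coe_finset]
  congr 1
  ext T
  simp [mem_frustratedFinset]

lemma ncard_edgeSet_induce (G : SimpleGraph V) (T : Finset V) :
    (G.induce (T : Set V)).edgeSet.ncard = #{e ∈ G.edgeFinset | e ∈ T.sym2} := by
  rw [← Set.ncard_coe_finset,
    ← Set.ncard_image_of_injective _ (Sym2.map.injective Subtype.val_injective)]
  congr 1
  ext e
  constructor
  · rintro ⟨e, he, rfl⟩
    induction e with | h x y =>
    have h := x.2
    have h' := y.2
    simp_all
  · induction e with | h x y =>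
    intro h
    simp only [coe_filter, Set.mem_ofPred_eq, SimpleGraph.mem_edgeFinset, mk_mem_sym2_iff,
      SimpleGraph.mem_edgeSet] at h
    exact ⟨s(⟨x, h.2.1⟩, ⟨y, h.2.2⟩), by simpa using h.1, rfl⟩

lemma triple_mem_iff {a b c : V} (hab : a ≠ b) (hac : a ≠ c) (hbc : b ≠ c) :
    ({a, b, c} : Finset V) ∈ frustratedTriangles G ↔
      Xor (Xor (G.Adj a b) (G.Adj b c)) (G.Adj a c) := by
  have h : ({e ∈ G.edgeFinset | e ∈ ({a, b, c} : Finset V).sym2}) =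
      ({e ∈ ({s(a, b), s(b, c), s(a, c)} : Finset (Sym2 V)) | e ∈ G.edgeSet}) := by
    ext e
    induction e with | h x y =>
    simp only [mem_filter, SimpleGraph.mem_edgeFinset, SimpleGraph.mem_edgeSet, mk_mem_sym2_iff,
      mem_insert, mem_singleton, Sym2.eq_iff]
    constructor
    · rintro ⟨h, hx | hx | hx, hy | hy | hy⟩ <;> subst hx hy <;> simp_all
    · rintro ⟨(⟨rfl, rfl⟩ | ⟨rfl, rfl⟩) | (⟨rfl, rfl⟩ | ⟨rfl, rfl⟩) | (⟨rfl, rfl⟩ | ⟨rfl, rfl⟩), h⟩ <;>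
        simp_all
  have h3 : #({a, b, c} : Finset V) = 3 := card_eq_three.2 ⟨a, b, c, hab, hac, hbc, rfl⟩
  have h1 : s(a, b) ≠ s(b, c) := by simp [hab, hac]
  have h2 : s(a, b) ≠ s(a, c) := by simp [hbc, hac]
  have h4 : s(b, c) ≠ s(a, c) := by simp [hab.symm, hbc]
  rw [frustratedTriangles, Set.mem_ofPred_eq, ncard_edgeSet_induce, h]
  by_cases x : G.Adj a b <;> by_cases y : G.Adj b c <;> by_cases z : G.Adj a c <;>
    simp [h3, filter_insert, filter_singleton, x, y, z, h1, h2, h4, Xor]; decide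

lemma frustratedTriangles_subset (h : ∀ a b c, a ≠ b → a ≠ c → b ≠ c →
    Xor (Xor (G.Adj a b) (G.Adj b c)) (G.Adj a c) →
    Xor (Xor (H.Adj a b) (H.Adj b c)) (H.Adj a c)) :
    frustratedTriangles G ⊆ frustratedTriangles H := by
  intro T hT
  obtain ⟨a, b, c, hab, hac, hbc, rfl⟩ := exists_triple_of_mem hT
  rw [triple_mem_iff hab hac hbc] at hT ⊢
  exact h a b c hab hac hbc hT

lemma frustratedCount_compl (G : SimpleGraph V) :
    frustratedCount G + frustratedCount Gᶜ = (Fintype.card V).choose 3 := by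
  rw [frustratedCount_eq_card, frustratedCount_eq_card, ← card_union_of_disjoint,
    ← card_univ, ← card_powersetCard]
  · congr 1
    ext T
    simp only [mem_union, mem_frustratedFinset, mem_powersetCard, subset_univ, true_and]
    constructor
    · rintro (h | h) <;> exact h.1
    · intro h
      obtain ⟨a, b, c, hab, hac, hbc, rfl⟩ := card_eq_three.1 h
      rw [triple_mem_iff hab hac hbc, triple_mem_iff hab hac hbc]
      simp only [SimpleGraph.compl_adj, Xor]
      tauto
  · rw [disjoint_left]
    intro T hT hT'
    rw [mem_frustratedFinset] at hT hT'
    obtain ⟨a, b, c, hab, hac, hbc, rfl⟩ := exists_triple_of_mem hT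
    rw [triple_mem_iff hab hac hbc] at hT hT'
    simp only [SimpleGraph.compl_adj, Xor] at hT hT'
    tauto

/-- The triples of vertices that contain the edge `e`. -/
noncomputable def triplesOver (e : Sym2 V) : Finset (Finset V) :=
  {T ∈ powersetCard 3 univ | e ∈ T.sym2}

lemma triplesOver_mk {u v : V} (h : u ≠ v) :
    triplesOver s(u, v) = (univ \ {u, v}).image fun w ↦ {u, v, w} := by
  ext T
  simp only [triplesOver, mem_filter, mem_powersetCard, subset_univ, true_and, mk_mem_sym2_iff,
    mem_image, mem_sdiff, mem_univ, mem_insert, mem_singleton, not_or]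
  constructor
  · rintro ⟨hT, hu, hv⟩
    have h1 : #((T.erase u).erase v) = 1 := by
      rw [card_erase_of_mem (by simp [h.symm, hv]), card_erase_of_mem hu, hT]
    obtain ⟨w, hw⟩ := card_eq_one.1 h1
    have hw' : w ∈ (T.erase u).erase v := by simp [hw]
    simp only [mem_erase] at hw'
    refine ⟨w, ⟨hw'.2.1, hw'.1⟩, ?_⟩
    rw [← hw, insert_erase (by simp [h.symm, hv]), insert_erase hu]
  · rintro ⟨w, ⟨h1, h2⟩, rfl⟩
    exact ⟨card_eq_three.2 ⟨u, v, w, h, Ne.symm h1, Ne.symm h2, rfl⟩, by simp, by simp⟩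

lemma card_triplesOver {e : Sym2 V} (he : ¬ e.IsDiag) :
    #(triplesOver e) = Fintype.card V - 2 := by
  induction e with | h u v =>
  have h : u ≠ v := by simpa using he
  rw [triplesOver_mk h, card_image_of_injOn, card_sdiff_of_subset (subset_univ _), card_pair h,
    card_univ]
  exact insert_triple_injOn.mono fun w hw ↦ by simpa using hw

lemma sum_card_edges (G : SimpleGraph V) :
    ∑ T ∈ powersetCard 3 univ, #{e ∈ G.edgeFinset | e ∈ T.sym2} =
      #G.edgeFinset * (Fintype.card V - 2) := by
  have := sum_card_bipartiteAbove_eq_sum_card_bipartiteBelow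
    (s := powersetCard 3 (univ : Finset V)) (t := G.edgeFinset) fun T e ↦ e ∈ T.sym2
  simp only [bipartiteAbove, bipartiteBelow] at this
  rw [this, sum_const_nat]
  intro e he
  exact card_triplesOver (G.not_isDiag_of_mem_edgeFinset he)

lemma frustratedFinset_eq_filter (G : SimpleGraph V) :
    frustratedFinset G =
      {T ∈ powersetCard 3 (univ : Finset V) | Odd #{e ∈ G.edgeFinset | e ∈ T.sym2}} := by
  ext T
  rw [mem_frustratedFinset, frustratedTriangles, Set.mem_ofPred_eq, ncard_edgeSet_induce]
  simp

/-- The indicator of an odd number of edges is congruent mod 2 to that number, so the double count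
`sum_card_edges` applies. -/
lemma frustratedCount_mod_two (G : SimpleGraph V) :
    frustratedCount G % 2 = #G.edgeFinset * (Fintype.card V - 2) % 2 := by
  rw [← sum_card_edges, frustratedCount_eq_card, frustratedFinset_eq_filter, card_filter,
    sum_nat_mod, sum_nat_mod (powersetCard 3 (univ : Finset V)) 2 (fun T ↦ #_)]
  congr 1
  refine sum_congr rfl fun T _ ↦ ?_
  split_ifs with h
  · rw [Nat.odd_iff.1 h]
  · rw [Nat.not_odd_iff.1 h]

lemma frustratedCount_le (G : SimpleGraph V) :
    frustratedCount G ≤ #G.edgeFinset * (Fintype.card V - 2) := by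
  rw [← sum_card_edges, frustratedCount_eq_card, frustratedFinset_eq_filter, card_filter]
  refine sum_le_sum fun T _ ↦ ?_
  split_ifs with h
  · exact h.pos
  · exact Nat.zero_le _

lemma frustratedCount_le_add_deleteEdge (G : SimpleGraph V) {e : Sym2 V} (he : e ∈ G.edgeSet) :
    frustratedCount G ≤ frustratedCount (G.deleteEdges {e}) + (Fintype.card V - 2) := by
  rw [← card_triplesOver (G.not_isDiag_of_mem_edgeSet he), frustratedCount_eq_card,
    frustratedCount_eq_card]
  refine (card_le_card fun T hT ↦ ?_).trans (card_union_le _ _)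
  rw [mem_union, frustratedFinset_eq_filter, triplesOver]
  rw [frustratedFinset_eq_filter] at hT
  simp only [mem_filter] at hT ⊢
  by_cases h : e ∈ T.sym2
  · exact Or.inr ⟨hT.1, h⟩
  · left
    have hx : ({x ∈ (G.deleteEdges {e}).edgeFinset | x ∈ T.sym2}) =
        {x ∈ G.edgeFinset | x ∈ T.sym2} := by
      ext x
      simp only [mem_filter, SimpleGraph.mem_edgeFinset, SimpleGraph.edgeSet_deleteEdges,
        Set.mem_sdiff, Set.mem_singleton_iff]
      constructor
      · rintro ⟨⟨h1, _⟩, h2⟩; exact ⟨h1, h2⟩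
      · rintro ⟨h1, h2⟩; exact ⟨⟨h1, fun hx ↦ h (hx ▸ h2)⟩, h2⟩
    refine ⟨hT.1, ?_⟩
    rw [← hx] at hT
    convert hT.2

/-- Of the n - 2 triples over an edge, each other edge spoils at most one; the rest contain that
edge alone and are frustrated. The families `S e` are disjoint because a triple in one of them
determines its only edge. -/
lemma le_frustratedCount (G : SimpleGraph V) :
    #G.edgeFinset * (Fintype.card V - 1 - #G.edgeFinset) ≤ frustratedCount G := by
  set t := #G.edgeFinset
  let S (e : Sym2 V) : Finset (Finset V) :=
    {T ∈ powersetCard 3 univ | {x ∈ G.edgeFinset | x ∈ T.sym2} = {e}}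
  have hS : ∀ e ∈ G.edgeFinset, Fintype.card V - 1 - t ≤ #(S e) := by
    intro e he
    have hd := G.not_isDiag_of_mem_edgeFinset he
    have h1 : triplesOver e ⊆ S e ∪ (G.edgeFinset.erase e).biUnion
        fun x ↦ {T ∈ powersetCard 3 univ | e ∈ T.sym2 ∧ x ∈ T.sym2} := by
      intro T hT
      simp only [triplesOver, mem_filter] at hT
      simp only [mem_union, mem_biUnion, mem_erase, S, mem_filter, hT, true_and]
      by_contra! hc
      refine hc.1 (Finset.ext fun x ↦ ?_)
      simp only [mem_filter, mem_singleton]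
      constructor
      · rintro ⟨hx, hx'⟩
        by_contra hne
        exact hc.2 x ⟨hne, hx⟩ hx'
      · rintro rfl
        exact ⟨he, hT.2⟩
    have h2 : ∀ x ∈ G.edgeFinset.erase e,
        #{T ∈ powersetCard 3 (univ : Finset V) | e ∈ T.sym2 ∧ x ∈ T.sym2} ≤ 1 := by
      intro x hx
      rw [mem_erase] at hx
      rw [card_le_one]
      intro T hT T' hT'
      simp only [mem_filter, mem_powersetCard, subset_univ, true_and] at hT hT'
      induction e with | h u v =>
      induction x with | h y z =>
      have huv : u ≠ v := by simpa using hd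
      have hyz : y ≠ z := by simpa using G.not_isDiag_of_mem_edgeFinset hx.2
      simp only [mk_mem_sym2_iff] at hT hT'
      -- A triple over both edges must consist of `u`, `v` and an endpoint of the second edge off
      -- the first.
      obtain ⟨w, hwu, hwv, hw⟩ : ∃ w, w ≠ u ∧ w ≠ v ∧ (w = y ∨ w = z) := by
        have := hx.1
        simp only [ne_eq, Sym2.eq_iff, not_or, not_and] at this
        by_cases hyu : y = u
        · exact ⟨z, fun h ↦ hyz (hyu.trans h.symm), this.1 hyu, Or.inr rfl⟩
        by_cases hyv : y = v
        · exact ⟨z, this.2 hyv, fun h ↦ hyz (hyv.trans h.symm), Or.inr rfl⟩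
        exact ⟨y, hyu, hyv, Or.inl rfl⟩
      have key : ∀ T : Finset V, #T = 3 → u ∈ T → v ∈ T → y ∈ T → z ∈ T → {u, v, w} = T := by
        intro T h3 hu hv hy hz
        refine eq_of_subset_of_card_le ?_ ?_
        · intro a ha
          simp only [mem_insert, mem_singleton] at ha
          rcases ha with rfl | rfl | rfl
          · exact hu
          · exact hv
          · rcases hw with rfl | rfl <;> assumption
        · rw [h3, card_eq_three.2 ⟨u, v, w, huv, hwu.symm, hwv.symm, rfl⟩]
      rw [← key T hT.1 hT.2.1.1 hT.2.1.2 hT.2.2.1 hT.2.2.2,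
        ← key T' hT'.1 hT'.2.1.1 hT'.2.1.2 hT'.2.2.1 hT'.2.2.2]
    have h3 := (card_le_card h1).trans (card_union_le _ _)
    have h4 := card_biUnion_le_card_mul _ _ 1 h2
    rw [card_triplesOver hd] at h3
    rw [card_erase_of_mem he] at h4
    have : 0 < t := card_pos.2 ⟨e, he⟩
    change _ ≤ (t - 1) * 1 at h4
    omega
  calc t * (Fintype.card V - 1 - t) ≤ ∑ e ∈ G.edgeFinset, #(S e) := by
        rw [← smul_eq_mul]; exact card_nsmul_le_sum _ _ _ hS
    _ = #(G.edgeFinset.biUnion S) := by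
        rw [card_biUnion]
        intro e _ e' _ hne
        rw [Function.onFun, disjoint_left]
        intro T hT hT'
        simp only [S, mem_filter] at hT hT'
        exact hne (singleton_injective (hT.2.symm.trans hT'.2))
    _ ≤ frustratedCount G := by
        rw [frustratedCount_eq_card, frustratedFinset_eq_filter]
        refine card_le_card fun T hT ↦ ?_
        simp only [mem_biUnion, S, mem_filter] at hT ⊢
        obtain ⟨e, _, h, h'⟩ := hT
        exact ⟨h, by rw [h']; simp⟩

/-- The graph on the vertices other than `v` that joins `u` and `w` if `v, u, w` is frustrated. -/
def SimpleGraph.frustratedLink (G : SimpleGraph V) (v : V) : SimpleGraph V where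
  Adj u w := u ≠ w ∧ u ≠ v ∧ w ≠ v ∧ ({v, u, w} : Finset V) ∈ frustratedTriangles G
  symm := ⟨fun u w h ↦ ⟨h.1.symm, h.2.2.1, h.2.1, by rw [pair_comm]; exact h.2.2.2⟩⟩
  loopless := ⟨fun u h ↦ h.1 rfl⟩

lemma xor_triangle (p q r x y z : Prop) :
    Xor (Xor (Xor (Xor p x) q) (Xor (Xor q y) r)) (Xor (Xor p z) r) ↔ Xor (Xor x y) z := by
  by_cases hp : p <;> by_cases hq : q <;> by_cases hr : r <;> by_cases hx : x <;>
    by_cases hy : y <;> by_cases hz : z <;> simp [hp, hq, hr, hx, hy, hz]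

/-- Modulo 2, the link changes the adjacency of `a` and `b` by adding those of `v a` and `v b`: it
is the switching that isolates `v`. Around a triangle each added term occurs twice and cancels. -/
lemma frustratedTriangles_frustratedLink (G : SimpleGraph V) (v : V) :
    frustratedTriangles (G.frustratedLink v) = frustratedTriangles G := by
  have key : ∀ a b c, a ≠ b → a ≠ c → b ≠ c →
      (Xor (Xor ((G.frustratedLink v).Adj a b) ((G.frustratedLink v).Adj b c))
        ((G.frustratedLink v).Adj a c) ↔ Xor (Xor (G.Adj a b) (G.Adj b c)) (G.Adj a c)) := by
    have h1 : ∀ a b, a ≠ b → a ≠ v → b ≠ v →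
        ((G.frustratedLink v).Adj a b ↔ Xor (Xor (G.Adj v a) (G.Adj a b)) (G.Adj v b)) := by
      intro a b hab hav hbv
      rw [← triple_mem_iff hav.symm hbv.symm hab]
      simp [SimpleGraph.frustratedLink, hab, hav, hbv]
    have h2 : ∀ a, ¬ (G.frustratedLink v).Adj a v := fun a h ↦ h.2.2.1 rfl
    have h3 : ∀ a, ¬ (G.frustratedLink v).Adj v a := fun a h ↦ h.2.1 rfl
    intro a b c hab hac hbc
    by_cases ha : a = v
    · subst ha
      rw [h1 b c hbc hab.symm hac.symm]
      simp only [h3, xor_iff_not_iff]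
      tauto
    by_cases hb : b = v
    · subst hb
      rw [h1 a c hac hab hbc.symm, G.adj_comm b a]
      simp only [h3, h2, xor_iff_not_iff]
      tauto
    by_cases hc : c = v
    · subst hc
      rw [h1 a b hab hac hbc, G.adj_comm c a, G.adj_comm c b]
      simp only [h2, xor_iff_not_iff]
      tauto
    rw [h1 a b hab ha hb, h1 b c hbc hb hc, h1 a c hac ha hc]
    exact xor_triangle _ _ _ _ _ _
  exact Set.Subset.antisymm
    (frustratedTriangles_subset fun a b c x y z ↦ (key a b c x y z).1)
    (frustratedTriangles_subset fun a b c x y z ↦ (key a b c x y z).2)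

lemma card_edgeFinset_frustratedLink_le (G : SimpleGraph V) (v : V) :
    #(G.frustratedLink v).edgeFinset ≤ #{T ∈ frustratedFinset G | v ∈ T} := by
  refine card_le_card_of_injOn (fun e ↦ insert v e.toFinset) ?_ ?_
  · intro e he
    induction e with | h x y =>
    simp only [SimpleGraph.coe_edgeFinset, SimpleGraph.mem_edgeSet] at he
    simp only [Sym2.toFinset_mk_eq, coe_filter, Set.mem_ofPred_eq, mem_frustratedFinset, mem_insert,
      true_or, and_true]
    exact he.2.2.2
  · intro e he e' he' h
    have hv : ∀ e ∈ (G.frustratedLink v).edgeSet, v ∉ e.toFinset := by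
      intro e he
      induction e with | h x y =>
      simp only [Sym2.mem_toFinset, Sym2.mem_iff, not_or]
      exact ⟨he.2.1.symm, he.2.2.1.symm⟩
    simp only [SimpleGraph.coe_edgeFinset] at he he'
    have h' : insert v e.toFinset = insert v e'.toFinset := h
    have := congrArg (fun s ↦ s.erase v) h'
    simp only [erase_insert (hv e he), erase_insert (hv e' he')] at this
    ext x
    rw [← Sym2.mem_toFinset, this, Sym2.mem_toFinset]

/-- Every frustrated set is that of a graph with few edges. -/
lemma exists_card_edgeFinset_le (G : SimpleGraph V) :
    ∃ H : SimpleGraph V, frustratedCount H = frustratedCount G ∧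
      Fintype.card V * #H.edgeFinset ≤ 3 * frustratedCount G := by
  -- In a graph with fewest edges in its switching class, every vertex lies in at least as many
  -- frustrated triples as there are edges, by comparison with its link. Summing over vertices
  -- counts each triple three times.
  obtain ⟨H, hH, hmin⟩ := exists_min_image
    ({H | frustratedTriangles H = frustratedTriangles G} : Finset (SimpleGraph V))
    (fun H ↦ #H.edgeFinset) ⟨G, by simp⟩
  simp only [mem_filter, mem_univ, true_and] at hH hmin
  have hc : frustratedCount H = frustratedCount G := by rw [frustratedCount, hH, frustratedCount]
  refine ⟨H, hc, ?_⟩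
  rw [← hc]
  have h1 : ∀ v ∈ (univ : Finset V), #H.edgeFinset ≤ #{T ∈ frustratedFinset H | v ∈ T} :=
    fun v _ ↦ (hmin _ ((frustratedTriangles_frustratedLink H v).trans hH)).trans
      (card_edgeFinset_frustratedLink_le H v)
  have h2 := card_nsmul_le_sum _ _ _ h1
  have h3 := sum_card_bipartiteAbove_eq_sum_card_bipartiteBelow
    (s := (univ : Finset V)) (t := frustratedFinset H) fun v T ↦ v ∈ T
  simp only [bipartiteAbove, bipartiteBelow] at h3
  rw [h3, card_univ, smul_eq_mul] at h2
  refine h2.trans (le_of_eq ?_)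
  rw [frustratedCount_eq_card, mul_comm]
  refine sum_const_nat fun T hT ↦ ?_
  simpa using (mem_frustratedFinset.1 hT).1

end Basic
-- Values that are missed.
section Counts

open Finset Classical

lemma six_mul_choose_three (n : ℕ) : 6 * n.choose 3 = n * (n - 1) * (n - 2) := by
  have h := Nat.descFactorial_eq_factorial_mul_choose n 3
  simp only [Nat.descFactorial, Nat.factorial] at h
  simp at h
  rw [← h]
  ring

lemma choose_three_sub_mem_iff {n m : ℕ} (hm : m ≤ n.choose 3) :
    n.choose 3 - m ∈ frustratedCounts n ↔ m ∈ frustratedCounts n := by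
  have key : ∀ k l, k + l = n.choose 3 → k ∈ frustratedCounts n → l ∈ frustratedCounts n := by
    rintro k l h ⟨G, rfl⟩
    refine ⟨Gᶜ, ?_⟩
    have := frustratedCount_compl G
    rw [Fintype.card_fin] at this
    omega
  exact ⟨key _ _ (by omega), key _ _ (by omega)⟩

lemma even_frustratedCount {V : Type*} [Fintype V] (hV : Even (Fintype.card V))
    (G : SimpleGraph V) : Even (frustratedCount G) := by
  rw [Nat.even_iff, frustratedCount_mod_two, ← Nat.even_iff]
  exact Even.mul_left (by grind) _

lemma even_choose_three {n : ℕ} (hn : Even n) : Even (n.choose 3) := by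
  have h := frustratedCount_compl (⊥ : SimpleGraph (Fin n))
  rw [Fintype.card_fin] at h
  rw [← h]
  exact (even_frustratedCount (by simpa) _).add (even_frustratedCount (by simpa) _)

/-- A number is not a frustrated count if it lies in a gap between the counts of graphs with at
most `t` and at least `q` edges, and no other number of edges has the right parity. -/
lemma notMem_frustratedCounts_of_gap {n t q m : ℕ} (h1 : t * (n - 2) < m)
    (h2 : m < q * (n - 1 - q)) (h3 : 3 * m < n * (n - 1 - q))
    (hpar : ∀ e, e * (n - 2) % 2 = m % 2 → t < e → q ≤ e) : m ∉ frustratedCounts n := by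
  rintro ⟨G, rfl⟩
  obtain ⟨H, hH, hle⟩ := exists_card_edgeFinset_le G
  have hu := frustratedCount_le H
  have hl := le_frustratedCount H
  have hp := frustratedCount_mod_two H
  rw [hH, Fintype.card_fin] at hu hl hp
  rw [Fintype.card_fin] at hle
  generalize #H.edgeFinset = e at *
  have ht : t < e := by
    by_contra! h
    exact absurd (h1.trans_le (hu.trans (Nat.mul_le_mul_right _ h))) (lt_irrefl _)
  have hq := hpar e hp.symm ht
  -- The function x(n - 1 - x) takes equal values at q and n - 1 - q and is no smaller in between.
  -- Few edges exclude e beyond the right end, so f ≥ q(n - 1 - q).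
  have he : e < n - 1 - q := lt_of_mul_lt_mul_left (hle.trans_lt h3) (Nat.zero_le _)
  obtain ⟨c, hc⟩ := Nat.exists_eq_add_of_lt he
  have e1 : n - 1 - e = q + (c + 1) := by omega
  have e2 : n - 1 - q = e + (c + 1) := by omega
  rw [e1] at hl
  rw [e2] at h2
  nlinarith

/-- With t = ⌊√n⌋ - 2, the difference (t + 1)(n - 2 - t) - t(n - 2) = n - 2 - t - t² is at least 3t
+ 2, leaving room for the offset 2, which makes the value even when n is. -/
lemma sqrt_sub_two_notMem_frustratedCounts {n : ℕ} (hn : 100 ≤ n) :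
    (n.sqrt - 2) * (n - 2) + 2 ∉ frustratedCounts n := by
  obtain ⟨t, ht⟩ : ∃ t, n.sqrt = t + 2 :=
    ⟨n.sqrt - 2, by have := Nat.le_sqrt.2 (show 2 * 2 ≤ n by omega); omega⟩
  obtain ⟨k, hk⟩ : ∃ k, n = (t + 2) * (t + 2) + k :=
    ⟨n - (t + 2) * (t + 2), by have := Nat.sqrt_le n; rw [ht] at this; omega⟩
  have ht8 : 8 ≤ t := by
    have := Nat.le_sqrt.2 (show 10 * 10 ≤ n by omega); omega
  have e1 : n - 2 = t * t + 4 * t + 2 + k := by rw [hk]; ring_nf; omega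
  have e2 : n - 1 - (t + 1) = t * t + 3 * t + 2 + k := by rw [hk]; ring_nf; omega
  have e3 : t + 2 - 2 = t := rfl
  rw [ht, e3]
  apply notMem_frustratedCounts_of_gap (t := t) (q := t + 1)
  · omega
  · rw [e1, e2]; nlinarith
  · rw [e1, e2, hk]; nlinarith [mul_nonneg (Nat.zero_le t) (Nat.zero_le k)]
  · intro e _ h; exact h

/-- The offset 2 preserves the parity of t(n - 2), and n - 2 is odd, so t + 1 edges are impossible.
The gap up to t + 2 edges has length 2n - t² - 3t - 6 ≥ 3t + 3, as (t + 3)² ≤ 2n. -/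
lemma sqrt_sub_three_notMem_frustratedCounts {n : ℕ} (hn : 100 ≤ n) (ho : Odd n) :
    ((2 * n).sqrt - 3) * (n - 2) + 2 ∉ frustratedCounts n := by
  obtain ⟨t, ht⟩ : ∃ t, (2 * n).sqrt = t + 3 :=
    ⟨(2 * n).sqrt - 3, by have := Nat.le_sqrt.2 (show 3 * 3 ≤ 2 * n by omega); omega⟩
  have hk : (t + 3) * (t + 3) ≤ 2 * n := by have := Nat.sqrt_le (2 * n); rwa [ht] at this
  have ht8 : 8 ≤ t := by
    have := Nat.le_sqrt.2 (show 11 * 11 ≤ 2 * n by omega); omega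
  obtain ⟨r, hr⟩ : ∃ r, n = r + t + 3 := ⟨n - t - 3, by
    have : t + 3 ≤ n := by nlinarith
    omega⟩
  have e1 : n - 2 = r + t + 1 := by omega
  have e2 : n - 1 - (t + 2) = r := by omega
  have e3 : t + 3 - 3 = t := rfl
  have hr4 : 4 * t ≤ r := by nlinarith
  rw [ht, e3]
  apply notMem_frustratedCounts_of_gap (t := t) (q := t + 2)
  · omega
  · rw [e1, e2]; nlinarith
  · rw [e1, e2, hr]; nlinarith
  · intro e h h'
    have ho' : (n - 2) % 2 = 1 := by obtain ⟨k, rfl⟩ := ho; omega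
    rw [Nat.add_mod, Nat.mul_mod, Nat.mul_mod t, ho'] at h
    omega

end Counts
-- Realizing values by star forests and a disjoint remainder.
section Construction

open Finset Classical

variable {V : Type*}

lemma exists_triple_of_mem_of_mem {T : Finset V} {c : V} (hT : #T = 3) (hc : c ∈ T) :
    ∃ y z, c ≠ y ∧ c ≠ z ∧ y ≠ z ∧ T = {c, y, z} := by
  have h : #(T.erase c) = 2 := by rw [card_erase_of_mem hc, hT]
  obtain ⟨y, z, hyz, h⟩ := card_eq_two.1 h
  have hy : y ∈ T.erase c := by simp [h]
  have hz : z ∈ T.erase c := by simp [h]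
  exact ⟨y, z, (ne_of_mem_erase hy).symm, (ne_of_mem_erase hz).symm, hyz, by
    rw [← h, insert_erase hc]⟩

variable [Fintype V]

/-- Some graph with all its edges inside `S` has exactly `m` frustrated triangles. -/
def RealizableOn (S : Finset V) (m : ℕ) : Prop :=
  ∃ G : SimpleGraph V, (∀ u v, G.Adj u v → u ∈ S) ∧ frustratedCount G = m

lemma RealizableOn.mono {S T : Finset V} {m : ℕ} (h : RealizableOn S m) (hST : S ⊆ T) :
    RealizableOn T m := by
  obtain ⟨G, hG, hm⟩ := h
  exact ⟨G, fun u v huv ↦ hST (hG u v huv), hm⟩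

lemma RealizableOn.zero (S : Finset V) : RealizableOn S 0 := by
  refine ⟨⊥, fun u v h ↦ h.elim, ?_⟩
  refine Nat.le_zero.1 ((frustratedCount_le _).trans_eq
    (mul_eq_zero_of_left (card_eq_zero.2 (eq_empty_of_forall_notMem fun e he ↦ ?_)) _))
  simp at he

/-- No triple carries edges of both graphs, since an edge in `S` and one in `T` span four vertices.
Hence the frustrated triples of the union are a disjoint union. -/
lemma RealizableOn.add {S T : Finset V} {k l : ℕ} (hS : RealizableOn S k)
    (hT : RealizableOn T l) (hST : Disjoint S T) : RealizableOn (S ∪ T) (k + l) := by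
  obtain ⟨G, hG, rfl⟩ := hS
  obtain ⟨H, hH, rfl⟩ := hT
  refine ⟨G ⊔ H, fun u v h ↦ ?_, ?_⟩
  · rw [mem_union]
    exact h.imp (hG u v) (hH u v)
  have hG' : ∀ u v, G.Adj u v → u ∉ T ∧ v ∉ T := fun u v h ↦
    ⟨disjoint_left.1 hST (hG u v h), disjoint_left.1 hST (hG v u h.symm)⟩
  have hH' : ∀ u v, H.Adj u v → u ∈ T ∧ v ∈ T := fun u v h ↦ ⟨hH u v h, hH v u h.symm⟩
  have hor : ∀ a b c, (¬ G.Adj a b ∧ ¬ G.Adj b c ∧ ¬ G.Adj a c) ∨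
      (¬ H.Adj a b ∧ ¬ H.Adj b c ∧ ¬ H.Adj a c) := by
    intro a b c
    have := hG' a b
    have := hG' b c
    have := hG' a c
    have := hH' a b
    have := hH' b c
    have := hH' a c
    tauto
  rw [frustratedCount_eq_card, frustratedCount_eq_card, frustratedCount_eq_card,
    ← card_union_of_disjoint]
  · congr 1
    ext T
    simp only [mem_union, mem_frustratedFinset]
    by_cases h3 : #T = 3
    · obtain ⟨a, b, c, hab, hac, hbc, rfl⟩ := card_eq_three.1 h3
      rw [triple_mem_iff hab hac hbc, triple_mem_iff hab hac hbc, triple_mem_iff hab hac hbc]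
      rcases hor a b c with h | h <;> simp [h]
    · exact iff_of_false (fun h ↦ h3 h.1) fun h ↦ h3 (h.elim (·.1) (·.1))
  · rw [disjoint_left]
    intro T hT hT'
    rw [mem_frustratedFinset] at hT hT'
    obtain ⟨a, b, c, hab, hac, hbc, rfl⟩ := exists_triple_of_mem hT
    rw [triple_mem_iff hab hac hbc] at hT hT'
    rcases hor a b c with h | h <;> simp [h] at hT hT'

/-- The star with `k` leaves has `k * (n - 1 - k)` frustrated triangles. -/
lemma realizableOn_star {S : Finset V} {k : ℕ} (hS : #S = k + 1) :
    RealizableOn S (k * (Fintype.card V - 1 - k)) := by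
  obtain ⟨c, hc⟩ : S.Nonempty := card_pos.1 (by omega)
  let G : SimpleGraph V :=
    { Adj := fun u v ↦ (u = c ∧ v ∈ S.erase c) ∨ (v = c ∧ u ∈ S.erase c)
      symm := ⟨fun u v h ↦ h.symm⟩
      loopless := ⟨fun u h ↦ by rcases h with ⟨rfl, h⟩ | ⟨rfl, h⟩ <;> simp at h⟩ }
  have hadj : ∀ u v, G.Adj u v ↔ (u = c ∧ v ∈ S.erase c) ∨ (v = c ∧ u ∈ S.erase c) :=
    fun _ _ ↦ Iff.rfl
  have hcen : ∀ y z, c ≠ y → c ≠ z → y ≠ z →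
      (({c, y, z} : Finset V) ∈ frustratedTriangles G ↔ Xor (y ∈ S) (z ∈ S)) := by
    intro y z hy hz hyz
    rw [triple_mem_iff hy hz hyz]
    simp [hadj, hy.symm, hz.symm, Xor]
  refine ⟨G, fun u v h ↦ ?_, ?_⟩
  · rcases (hadj u v).1 h with ⟨rfl, _⟩ | ⟨_, h⟩
    · exact hc
    · exact mem_of_mem_erase h
  -- A frustrated triple consists of the centre, one leaf and one vertex off the star.
  have himg : frustratedFinset G =
      (S.erase c ×ˢ Sᶜ).image fun x ↦ ({c, x.1, x.2} : Finset V) := by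
    ext T
    simp only [mem_frustratedFinset, mem_image, mem_product, Prod.exists]
    constructor
    · intro hT
      have hcT : c ∈ T := by
        obtain ⟨x, y, z, hxy, hxz, hyz, rfl⟩ := exists_triple_of_mem hT
        rw [triple_mem_iff hxy hxz hyz] at hT
        by_contra h
        simp only [mem_insert, mem_singleton, not_or] at h
        simp [hadj, Ne.symm h.1, Ne.symm h.2.1, Ne.symm h.2.2] at hT
      obtain ⟨y, z, hy, hz, hyz, rfl⟩ := exists_triple_of_mem_of_mem hT.1 hcT
      rw [hcen y z hy hz hyz] at hT
      rcases hT with h | h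
      · exact ⟨y, z, ⟨mem_erase.2 ⟨hy.symm, h.1⟩, mem_compl.2 h.2⟩, rfl⟩
      · exact ⟨z, y, ⟨mem_erase.2 ⟨hz.symm, h.1⟩, mem_compl.2 h.2⟩, by rw [pair_comm]⟩
    · rintro ⟨y, z, ⟨hy, hz⟩, rfl⟩
      rw [mem_erase] at hy
      rw [mem_compl] at hz
      rw [hcen y z hy.1.symm (fun h ↦ hz (h ▸ hc)) (fun h ↦ hz (h ▸ hy.2))]
      exact Or.inl ⟨hy.2, hz⟩
  rw [frustratedCount_eq_card, himg, card_image_of_injOn, card_product, card_erase_of_mem hc,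
    card_compl, hS]
  · congr 1
    omega
  · rintro ⟨y, z⟩ h ⟨y', z'⟩ h' he
    simp only [coe_product, Set.mem_prod, mem_coe, mem_erase, mem_compl] at h h'
    have he' : ({c, y, z} : Finset V) = {c, y', z'} := he
    have hy : y ∈ ({c, y', z'} : Finset V) := by rw [← he']; simp
    have hz : z ∈ ({c, y', z'} : Finset V) := by rw [← he']; simp
    simp only [mem_insert, mem_singleton] at hy hz
    have hy1 : y = y' := by
      rcases hy with rfl | rfl | rfl
      · exact absurd rfl h.1.1
      · rfl
      · exact absurd h.1.2 h'.2
    have hz1 : z = z' := by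
      rcases hz with rfl | rfl | rfl
      · exact absurd hc h.2
      · exact absurd h'.1.2 h.2
      · rfl
    rw [hy1, hz1]

/-- Take a graph inside `A` with fewest edges among those with count at least `l`; the complete
graph on `A` is a candidate. Deleting any edge drops the count below `l`, and by at most n - 2. -/
lemma exists_realizableOn_between (A : Finset V) {l : ℕ} (hl : 0 < l) (hA : l ≤ (#A).choose 3) :
    ∃ m, RealizableOn A m ∧ l ≤ m ∧ m < l + (Fintype.card V - 2) := by
  let K : SimpleGraph V :=
    { Adj := fun u v ↦ u ≠ v ∧ u ∈ A ∧ v ∈ A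
      symm := ⟨fun u v h ↦ ⟨h.1.symm, h.2.2, h.2.1⟩⟩
      loopless := ⟨fun u h ↦ h.1 rfl⟩ }
  have hK : l ≤ frustratedCount K := by
    refine hA.trans ?_
    rw [← card_powersetCard, frustratedCount_eq_card]
    refine card_le_card fun T hT ↦ ?_
    rw [mem_powersetCard] at hT
    obtain ⟨a, b, c, hab, hac, hbc, rfl⟩ := card_eq_three.1 hT.2
    rw [mem_frustratedFinset, triple_mem_iff hab hac hbc]
    have ha : a ∈ A := hT.1 (by simp)
    have hb : b ∈ A := hT.1 (by simp)
    have hc : c ∈ A := hT.1 (by simp)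
    simp [K, ha, hb, hc, hab, hac, hbc]
  obtain ⟨G, hG, hmin⟩ := exists_min_image
    ({G | (∀ u v, G.Adj u v → u ∈ A) ∧ l ≤ frustratedCount G} : Finset (SimpleGraph V))
    (fun G ↦ #G.edgeFinset) ⟨K, by simpa using ⟨fun u v h ↦ h.2.1, hK⟩⟩
  simp only [mem_filter, mem_univ, true_and] at hG hmin
  refine ⟨_, ⟨G, hG.1, rfl⟩, hG.2, ?_⟩
  obtain ⟨e, he⟩ : G.edgeFinset.Nonempty := by
    by_contra h
    have := frustratedCount_le G
    rw [not_nonempty_iff_eq_empty.1 h, card_empty, zero_mul] at this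
    omega
  have hle := frustratedCount_le_add_deleteEdge G (SimpleGraph.mem_edgeFinset.1 he)
  have hlt : frustratedCount (G.deleteEdges {e}) < l := by
    by_contra! h
    have h1 := hmin _ ⟨fun u v huv ↦ hG.1 u v (G.deleteEdges_le _ huv), h⟩
    refine absurd h1 (not_le.2 (card_lt_card ((ssubset_iff_of_subset fun x hx ↦ ?_).2
      ⟨e, he, ?_⟩)))
    · simp only [SimpleGraph.mem_edgeFinset, SimpleGraph.edgeSet_deleteEdges] at hx ⊢
      exact hx.1
    · simp
  omega

variable (V) in
/-- On any `2 * t` vertices some star forest has `t * (n - 2) - 2 * p` frustrated triangles. -/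
def StarForestRealizable (t p : ℕ) : Prop :=
  ∀ S : Finset V, 2 * t ≤ #S → ∃ m, m + 2 * p = t * (Fintype.card V - 2) ∧ RealizableOn S m

namespace StarForestRealizable

lemma star {k p : ℕ} (h : 2 * p = (k + 1) * k) : StarForestRealizable V (k + 1) p := by
  intro S hS
  obtain ⟨T, hTS, hT⟩ := exists_subset_card_eq (show k + 1 + 1 ≤ #S by omega)
  refine ⟨_, ?_, (realizableOn_star hT).mono hTS⟩
  have : k + 1 + 1 ≤ Fintype.card V := hT ▸ card_le_univ T
  obtain ⟨c, hc⟩ := Nat.exists_eq_add_of_le this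
  have e1 : Fintype.card V - 1 - (k + 1) = c := by omega
  have e2 : Fintype.card V - 2 = k + c := by omega
  rw [e1, e2, h]
  ring

lemma zero : StarForestRealizable V 0 0 :=
  fun S _ ↦ ⟨0, by simp, RealizableOn.zero S⟩

lemma add {t p s q : ℕ} (h : StarForestRealizable V t p) (h' : StarForestRealizable V s q) :
    StarForestRealizable V (t + s) (p + q) := by
  intro S hS
  obtain ⟨T, hTS, hT⟩ := exists_subset_card_eq (show 2 * t ≤ #S by omega)
  obtain ⟨k, hk, hk'⟩ := h T hT.ge
  obtain ⟨l, hl, hl'⟩ := h' (S \ T) (by rw [card_sdiff_of_subset hTS]; omega)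
  exact ⟨k + l, by linarith, (hk'.add hl' disjoint_sdiff).mono
    (union_subset hTS sdiff_subset)⟩

lemma mul_left {t p : ℕ} (h : StarForestRealizable V t p) (k : ℕ) :
    StarForestRealizable V (k * t) (k * p) := by
  induction k with
  | zero => simpa using zero
  | succ k ih => rw [Nat.succ_mul, Nat.succ_mul]; exact ih.add h

/-- Single edges have deficit 0, so they serve as padding. -/
lemma mono {t s p : ℕ} (h : StarForestRealizable V t p) (hts : t ≤ s) :
    StarForestRealizable V s p := by
  have := h.add ((star (V := V) (k := 0) (p := 0) rfl).mul_left (s - t))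
  convert this using 1 <;> omega

lemma exists_triangular (p : ℕ) : ∃ j r, 2 * p = (j + 1) * j + 2 * r ∧ r ≤ j := by
  induction p with
  | zero => exact ⟨0, 0, rfl, le_rfl⟩
  | succ p ih =>
    obtain ⟨j, r, h, hr⟩ := ih
    rcases hr.lt_or_eq with hlt | rfl
    · exact ⟨j, r + 1, by omega, hlt⟩
    · exact ⟨r + 1, 0, by linarith, Nat.zero_le _⟩

/-- Greedily using two large stars and then stars with two leaves. -/
lemma of_le {p a b t : ℕ} (ha : 2 * p ≤ a * a) (hb : 2 * a ≤ b * b) (ht : a + 3 * b + 2 ≤ t) :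
    StarForestRealizable V t p := by
  obtain ⟨j, r, h, hr⟩ := exists_triangular p
  obtain ⟨i, q, h', hq⟩ := exists_triangular r
  -- The stars have j + 1 and i + 1 leaves, and `q` further stars have two leaves and deficit 1
  -- each. The total j + i + 2 + 2q is at most a + 3b + 2.
  have hj : j ≤ a := by by_contra! hc; nlinarith
  have hi : i ≤ b := by by_contra! hc; nlinarith
  obtain ⟨x, hx⟩ : 2 ∣ (j + 1) * j := by rw [mul_comm]; exact (Nat.even_mul_succ_self j).two_dvd
  obtain ⟨y, hy⟩ : 2 ∣ (i + 1) * i := by rw [mul_comm]; exact (Nat.even_mul_succ_self i).two_dvd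
  have := ((star (V := V) hx.symm).add (star (V := V) hy.symm)).add
    ((star (V := V) (k := 1) (p := 1) rfl).mul_left q)
  rw [show x + y + q * 1 = p by omega] at this
  exact this.mono (by omega)

end StarForestRealizable

/-- The part off `S` overshoots m - t(n - 2) by less than n - 2, so what is left for the star forest
lies in a window of that length. -/
lemma exists_realizableOn_compl {S : Finset V} {t m : ℕ} (ht : 0 < t)
    (h1 : (t - 1) * (Fintype.card V - 2) ≤ m) (h2 : m ≤ (#Sᶜ).choose 3) :
    ∃ k r, k + r = m ∧ RealizableOn Sᶜ k ∧ (t - 1) * (Fintype.card V - 2) ≤ r ∧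
      r ≤ t * (Fintype.card V - 2) := by
  rcases le_or_gt m (t * (Fintype.card V - 2)) with h | h
  · exact ⟨0, m, zero_add m, RealizableOn.zero _, h1, h⟩
  · obtain ⟨k, hk, hk1, hk2⟩ := exists_realizableOn_between Sᶜ
      (l := m - t * (Fintype.card V - 2)) (by omega) (by omega)
    have h3 : t * (Fintype.card V - 2) =
        (t - 1) * (Fintype.card V - 2) + (Fintype.card V - 2) := by
      rw [← add_one_mul, Nat.sub_one_add_one ht.ne']
    rcases le_or_gt k m with hkm | hkm
    · exact ⟨k, m - k, by omega, hk, by omega, by omega⟩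
    · exfalso
      have : Fintype.card V - 2 ≤ t * (Fintype.card V - 2) := Nat.le_mul_of_pos_left _ ht
      omega

lemma exists_frustratedCount_eq_of_even {t m : ℕ} (hV : Even (Fintype.card V)) (ht : 0 < t)
    (hm : Even m) (hS : 2 * t ≤ Fintype.card V)
    (hp : ∀ p, 2 * p ≤ Fintype.card V → StarForestRealizable V t p)
    (h1 : (t - 1) * (Fintype.card V - 2) ≤ m) (h2 : m ≤ (Fintype.card V - 2 * t).choose 3) :
    ∃ G : SimpleGraph V, frustratedCount G = m := by
  obtain ⟨S, -, hS⟩ := exists_subset_card_eq (show 2 * t ≤ #(univ : Finset V) by simpa)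
  obtain ⟨k, r, rfl, hk, hr1, hr2⟩ := exists_realizableOn_compl (S := S) ht h1
    (by rwa [card_compl, hS])
  have hke : Even k := by obtain ⟨G, -, rfl⟩ := hk; exact even_frustratedCount hV G
  have hre : Even r := by grind
  obtain ⟨s, rfl⟩ := Nat.exists_eq_add_of_lt ht
  have he : Even ((0 + s + 1) * (Fintype.card V - 2)) := Even.mul_left (by grind) _
  rw [Nat.add_sub_cancel] at hr1
  obtain ⟨x, hx⟩ := hre
  obtain ⟨y, hy⟩ := he
  have hs := add_one_mul (0 + s) (Fintype.card V - 2)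
  obtain ⟨l, hl, hl'⟩ := hp (y - x) (by omega) S hS.ge
  obtain ⟨G, -, hG⟩ := hl'.add hk disjoint_compl_right
  exact ⟨G, by omega⟩

lemma exists_frustratedCount_eq_of_odd {t m : ℕ} (hV : Odd (Fintype.card V)) (ht : 0 < t)
    (hS : 2 * (t + 1) ≤ Fintype.card V)
    (hp : ∀ p, p ≤ Fintype.card V → StarForestRealizable V t p)
    (h1 : (t - 1) * (Fintype.card V - 2) ≤ m)
    (h2 : m ≤ (Fintype.card V - 2 * (t + 1)).choose 3) :
    ∃ G : SimpleGraph V, frustratedCount G = m := by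
  obtain ⟨S, -, hS⟩ := exists_subset_card_eq (show 2 * (t + 1) ≤ #(univ : Finset V) by simpa)
  obtain ⟨k, r, rfl, hk, hr1, hr2⟩ := exists_realizableOn_compl (S := S) ht h1
    (by rwa [card_compl, hS])
  obtain ⟨s, rfl⟩ := Nat.exists_eq_add_of_lt ht
  rw [Nat.add_sub_cancel] at hr1
  have hs := add_one_mul (0 + s) (Fintype.card V - 2)
  have hs' := add_one_mul (0 + s + 1) (Fintype.card V - 2)
  have hodd : (Fintype.card V - 2) % 2 = 1 := by obtain ⟨c, hc⟩ := hV; omega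
  rcases Nat.even_or_odd ((0 + s + 1) * (Fintype.card V - 2) - r) with ⟨p, h⟩ | ⟨p, h⟩
  · obtain ⟨l, hl, hl'⟩ := hp p (by omega) S (by omega)
    obtain ⟨G, -, hG⟩ := hl'.add hk disjoint_compl_right
    exact ⟨G, by omega⟩
  -- One more edge adds the odd number n - 2 and repairs the parity. The deficit may then reach 2(n
  -- - 2), hence the range p ≤ n instead of 2p ≤ n.
  · obtain ⟨l, hl, hl'⟩ := ((hp (((0 + s + 1 + 1) * (Fintype.card V - 2) - r) / 2) (by omega)).mono
      (Nat.le_add_right _ 1)) S hS.ge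
    obtain ⟨G, -, hG⟩ := hl'.add hk disjoint_compl_right
    exact ⟨G, by omega⟩

end Construction
-- Estimates in terms of y = n^(1/4).
section Asymptotics

lemma exists_fourth_root {n B : ℕ} (h : B ^ 4 ≤ n) :
    ∃ y : ℝ, (B : ℝ) ≤ y ∧ (n : ℝ) = y ^ 4 ∧ (n : ℝ) ^ (3 / 2 : ℝ) = y ^ 6 ∧
      (n : ℝ) ^ (5 / 4 : ℝ) = y ^ 5 := by
  have hn : (0 : ℝ) ≤ n := Nat.cast_nonneg n
  have key : ∀ k : ℕ, ((n : ℝ) ^ (1 / 4 : ℝ)) ^ k = (n : ℝ) ^ ((1 / 4 : ℝ) * k) := fun k ↦ by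
    rw [Real.rpow_mul hn, Real.rpow_natCast]
  refine ⟨(n : ℝ) ^ (1 / 4 : ℝ), ?_, ?_, ?_, ?_⟩
  · refine le_of_pow_le_pow_left₀ (n := 4) (by norm_num) (Real.rpow_nonneg hn _) ?_
    rw [key]
    norm_num
    exact_mod_cast h
  all_goals rw [key]; norm_num

lemma abs_gap_sub_le {c y s j : ℝ} (hc : 0 ≤ c) (hc' : c ≤ 3 / 2) (hy : 20 ≤ y)
    (hs : s ≤ c * y ^ 2) (hs' : c * y ^ 2 ≤ s + 1) (hj : 2 ≤ j) (hj' : j ≤ 3) :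
    |(s - j) * (y ^ 4 - 2) + 2 - c * y ^ 6| ≤ 20 * y ^ 5 := by
  have h4 : 160000 ≤ y ^ 4 := by
    calc (160000 : ℝ) = 20 ^ 4 := by norm_num
      _ ≤ y ^ 4 := by gcongr
  have h5 : 20 * y ^ 4 ≤ y ^ 5 := by
    rw [pow_succ y 4, mul_comm]; gcongr
  have h2 : y ^ 2 ≤ y ^ 4 := by gcongr <;> [linarith; norm_num]
  have hcy : c * y ^ 2 ≤ 3 / 2 * y ^ 2 := by gcongr
  have e : c * y ^ 6 = c * y ^ 2 * (y ^ 4 - 2) + 2 * (c * y ^ 2) := by ring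
  rw [abs_le]
  constructor
  · have : (c * y ^ 2 - 4) * (y ^ 4 - 2) ≤ (s - j) * (y ^ 4 - 2) :=
      mul_le_mul_of_nonneg_right (by linarith) (by linarith)
    nlinarith
  · have : (s - j) * (y ^ 4 - 2) ≤ (c * y ^ 2) * (y ^ 4 - 2) :=
      mul_le_mul_of_nonneg_right (by linarith) (by linarith)
    have : 0 ≤ c * y ^ 2 := by positivity
    linarith

/-- Here `q` is n or 2n, the bound on the deficit. The second star level costs b ≤ 2y + 1, which is
the source of the n^(5/4) error term: t·n ≤ c·y⁶ + 7y⁵. -/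
lemma exists_star_parameters {q : ℕ} {c y : ℝ} (hq : √(q : ℝ) = c * y ^ 2) (hc : c ≤ 3 / 2)
    (hy : 20 ≤ y) :
    ∃ a b t : ℕ, q ≤ a * a ∧ 2 * a ≤ b * b ∧ a + 3 * b + 2 = t ∧
      (t : ℝ) ≤ c * y ^ 2 + 7 * y := by
  refine ⟨q.sqrt + 1, (2 * (q.sqrt + 1)).sqrt + 1, _, (Nat.lt_succ_sqrt _).le,
    (Nat.lt_succ_sqrt _).le, rfl, ?_⟩
  have h1 : (q.sqrt : ℝ) ≤ c * y ^ 2 := hq ▸ Real.nat_sqrt_le_real_sqrt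
  have h2 : ((2 * (q.sqrt + 1)).sqrt : ℝ) ≤ 2 * y := by
    refine Real.nat_sqrt_le_real_sqrt.trans (Real.sqrt_le_iff.2 ⟨by linarith, ?_⟩)
    push_cast
    nlinarith
  push_cast
  linarith

/-- Removing at most a fifth of the vertices leaves over half of the triples, because (4/5)³ =
64/125 > 1/2. -/
lemma le_choose_three_of_two_mul_le {n T m : ℕ} (hT : 10 * (T + 1) ≤ n)
    (hm : 2 * m ≤ n.choose 3) : m ≤ (n - 2 * T).choose 3 := by
  obtain ⟨k, hk⟩ : ∃ k, n - 2 * T = k + 2 := ⟨n - 2 * T - 2, by omega⟩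
  have h1 := six_mul_choose_three n
  have h2 := six_mul_choose_three (k + 2)
  have h3 : n * (n - 1) * (n - 2) ≤ n ^ 3 := by
    rw [pow_succ, sq]; gcongr <;> omega
  have h4 : k ^ 3 ≤ (k + 2) * (k + 2 - 1) * (k + 2 - 2) := by
    rw [pow_succ, sq]; gcongr <;> omega
  have h5 : (4 * n) ^ 3 ≤ (5 * k) ^ 3 := Nat.pow_le_pow_left (by omega) 3
  rw [mul_pow, mul_pow] at h5
  rw [hk]
  omega

lemma mul_add_two_le_choose_three {n k : ℕ} (hn : 100 ≤ n) (hk : k ≤ n) :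
    k * (n - 2) + 2 ≤ n.choose 3 := by
  obtain ⟨l, rfl⟩ := Nat.exists_eq_add_of_le hn
  have h := six_mul_choose_three (100 + l)
  have e1 : 100 + l - 1 = 99 + l := by omega
  have e2 : 100 + l - 2 = 98 + l := by omega
  rw [e1, e2] at h
  rw [e2]
  have h1 : k * (98 + l) ≤ (100 + l) * (98 + l) := Nat.mul_le_mul_right _ hk
  nlinarith [Nat.zero_le (l ^ 3), Nat.zero_le (l ^ 2)]

lemma mem_frustratedCounts_of_even_of_two_mul_le {n m : ℕ} {y : ℝ} (hy : 20 ≤ y)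
    (hny : (n : ℝ) = y ^ 4) (hn : Even n) (hm : Even m) (h : y ^ 6 + 20 * y ^ 5 ≤ m)
    (h2 : 2 * m ≤ n.choose 3) : m ∈ frustratedCounts n := by
  have hq : √(n : ℝ) = 1 * y ^ 2 := by
    rw [hny, Real.sqrt_eq_iff_eq_sq] <;> [ring; positivity; positivity]
  obtain ⟨a, b, t, ha, hb, ht, hty⟩ := exists_star_parameters hq (by norm_num) hy
  have hT : 10 * (t + 1) ≤ n := by
    rify
    rw [hny]
    nlinarith [sq_nonneg (y ^ 2 - 200)]
  have htn : t * n ≤ m := by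
    rify
    rw [hny]
    refine (mul_le_mul_of_nonneg_right hty (by positivity)).trans (le_trans ?_ h)
    have : 0 ≤ y ^ 5 := by positivity
    linarith
  refine exists_frustratedCount_eq_of_even (V := Fin n) (t := t) (by simpa) (by omega) hm
    (by rw [Fintype.card_fin]; omega) (fun p hp ↦ ?_) ?_ ?_
  · rw [Fintype.card_fin] at hp
    exact StarForestRealizable.of_le (hp.trans ha) hb ht.le
  · rw [Fintype.card_fin]
    exact (Nat.mul_le_mul (Nat.sub_le _ _) (Nat.sub_le _ _)).trans htn
  · rw [Fintype.card_fin]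
    exact le_choose_three_of_two_mul_le hT h2

lemma mem_frustratedCounts_of_odd_of_two_mul_le {n m : ℕ} {y : ℝ} (hy : 20 ≤ y)
    (hny : (n : ℝ) = y ^ 4) (hn : Odd n) (h : √2 * y ^ 6 + 20 * y ^ 5 ≤ m)
    (h2 : 2 * m ≤ n.choose 3) : m ∈ frustratedCounts n := by
  have hq : √((2 * n : ℕ) : ℝ) = √2 * y ^ 2 := by
    push_cast
    rw [Real.sqrt_mul (by norm_num), hny, show y ^ 4 = (y ^ 2) ^ 2 by ring,
      Real.sqrt_sq (by positivity)]
  have hc : √2 ≤ 3 / 2 := Real.sqrt_le_iff.2 (by norm_num)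
  obtain ⟨a, b, t, ha, hb, ht, hty⟩ := exists_star_parameters hq hc hy
  have hcy : √2 * y ^ 2 ≤ 3 / 2 * y ^ 2 := by gcongr
  have hT : 10 * (t + 1 + 1) ≤ n := by
    rify
    rw [hny]
    nlinarith [sq_nonneg (y ^ 2 - 200)]
  have htn : t * n ≤ m := by
    rify
    rw [hny]
    refine (mul_le_mul_of_nonneg_right hty (by positivity)).trans (le_trans ?_ h)
    have : 0 ≤ y ^ 5 := by positivity
    linarith
  refine exists_frustratedCount_eq_of_odd (V := Fin n) (t := t) (by simpa) (by omega)
    (by rw [Fintype.card_fin]; omega) (fun p hp ↦ ?_) ?_ ?_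
  · rw [Fintype.card_fin] at hp
    exact StarForestRealizable.of_le ((Nat.mul_le_mul_left 2 hp).trans ha) hb ht.le
  · rw [Fintype.card_fin]
    exact (Nat.mul_le_mul (Nat.sub_le _ _) (Nat.sub_le _ _)).trans htn
  · rw [Fintype.card_fin]
    exact le_choose_three_of_two_mul_le hT h2

/-- Reduction to the lower half by complementation. -/
lemma mem_frustratedCounts_of_lower_half {n m : ℕ} {x : ℝ} {P : ℕ → Prop} (hx : 0 ≤ x)
    (hP : ∀ k, k ≤ n.choose 3 → P k → P (n.choose 3 - k))
    (h : ∀ k : ℕ, P k → x ≤ k → 2 * k ≤ n.choose 3 → k ∈ frustratedCounts n)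
    (hm : P m) (h1 : x ≤ m) (h2 : (m : ℝ) ≤ n.choose 3 - x) : m ∈ frustratedCounts n := by
  have hle : m ≤ n.choose 3 := by
    have : (m : ℝ) ≤ n.choose 3 := by linarith
    exact_mod_cast this
  rcases le_or_gt (2 * m) (n.choose 3) with h' | h'
  · exact h m hm h1 h'
  · rw [← choose_three_sub_mem_iff hle]
    refine h _ (hP m hle hm) ?_ (by omega)
    rw [Nat.cast_sub hle]
    linarith

lemma notMem_frustratedCounts_upper {n m : ℕ} {x ε : ℝ} (hle : m ≤ n.choose 3)
    (hm : m ∉ frustratedCounts n) (h : |(m : ℝ) - x| ≤ ε) :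
    n.choose 3 - m ≤ n.choose 3 ∧ n.choose 3 - m ∉ frustratedCounts n ∧
      |((n.choose 3 - m : ℕ) : ℝ) - (n.choose 3 - x)| ≤ ε := by
  refine ⟨Nat.sub_le _ _, by rwa [choose_three_sub_mem_iff hle], ?_⟩
  rw [Nat.cast_sub hle, ← abs_neg]
  convert h using 2
  ring

end Asymptotics


/-! ### Assembly, with C = 20 and n ≥ 20⁴, that is y ≥ 20. -/

theorem theorem2 :
    -- the case of even `n`
    (∃ C : ℝ, 0 < C ∧ ∃ N : ℕ, ∀ n : ℕ, N ≤ n → Even n →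
      (∀ m : ℕ, Even m →
        (n : ℝ) ^ (3 / 2 : ℝ) + C * (n : ℝ) ^ (5 / 4 : ℝ) ≤ (m : ℝ) →
        (m : ℝ) ≤ (n.choose 3 : ℝ) -
          ((n : ℝ) ^ (3 / 2 : ℝ) + C * (n : ℝ) ^ (5 / 4 : ℝ)) →
        m ∈ frustratedCounts n) ∧
      (∃ m : ℕ, Even m ∧ m ≤ n.choose 3 ∧ m ∉ frustratedCounts n ∧
        |(m : ℝ) - (n : ℝ) ^ (3 / 2 : ℝ)| ≤ C * (n : ℝ) ^ (5 / 4 : ℝ)) ∧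
      (∃ m : ℕ, Even m ∧ m ≤ n.choose 3 ∧ m ∉ frustratedCounts n ∧
        |(m : ℝ) - ((n.choose 3 : ℝ) - (n : ℝ) ^ (3 / 2 : ℝ))| ≤
          C * (n : ℝ) ^ (5 / 4 : ℝ))) ∧
    -- the case of odd `n`
    (∃ C : ℝ, 0 < C ∧ ∃ N : ℕ, ∀ n : ℕ, N ≤ n → Odd n →
      (∀ m : ℕ,
        √2 * (n : ℝ) ^ (3 / 2 : ℝ) + C * (n : ℝ) ^ (5 / 4 : ℝ) ≤ (m : ℝ) →
        (m : ℝ) ≤ (n.choose 3 : ℝ) -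
          (√2 * (n : ℝ) ^ (3 / 2 : ℝ) + C * (n : ℝ) ^ (5 / 4 : ℝ)) →
        m ∈ frustratedCounts n) ∧
      (∃ m : ℕ, m ≤ n.choose 3 ∧ m ∉ frustratedCounts n ∧
        |(m : ℝ) - √2 * (n : ℝ) ^ (3 / 2 : ℝ)| ≤ C * (n : ℝ) ^ (5 / 4 : ℝ)) ∧
      (∃ m : ℕ, m ≤ n.choose 3 ∧ m ∉ frustratedCounts n ∧
        |(m : ℝ) - ((n.choose 3 : ℝ) - √2 * (n : ℝ) ^ (3 / 2 : ℝ))| ≤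
          C * (n : ℝ) ^ (5 / 4 : ℝ))) := by

  constructor
  · refine ⟨20, by norm_num, 20 ^ 4, fun n hn he ↦ ?_⟩
    obtain ⟨y, hy, hny, h6, h5⟩ := exists_fourth_root hn
    norm_num only [Nat.cast_ofNat] at hy
    rw [h6, h5]
    have hq : √(n : ℝ) = 1 * y ^ 2 := by
      rw [hny, Real.sqrt_eq_iff_eq_sq] <;> [ring; positivity; positivity]
    have hs2 : 2 ≤ n.sqrt := Nat.le_sqrt.2 (by omega)
    set m := (n.sqrt - 2) * (n - 2) + 2 with hm
    have hme : Even m := (Even.mul_left (by grind) _).add even_two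
    have hmem : m ∉ frustratedCounts n := sqrt_sub_two_notMem_frustratedCounts (by omega)
    have hle : m ≤ n.choose 3 := mul_add_two_le_choose_three (by omega)
      ((Nat.sub_le _ _).trans (Nat.sqrt_le_self n))
    have habs : |(m : ℝ) - y ^ 6| ≤ 20 * y ^ 5 := by
      have := abs_gap_sub_le (c := 1) (s := n.sqrt) (j := 2) (by norm_num) (by norm_num) hy
        (hq ▸ Real.nat_sqrt_le_real_sqrt) (hq ▸ Real.real_sqrt_le_nat_sqrt_succ) le_rfl
        (by norm_num)
      rw [hm]
      push_cast [Nat.cast_sub hs2, Nat.cast_sub (show 2 ≤ n by omega)]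
      rwa [hny, ← one_mul (y ^ 6)]
    -- For even n the number C(n,3) is even, so reflection preserves evenness.
    refine ⟨fun k hk h1 h2 ↦ mem_frustratedCounts_of_lower_half (P := Even) (by positivity)
      (fun l hl hl' ↦ (Nat.even_sub hl).2 (iff_of_true (even_choose_three he) hl'))
      (fun l hl ↦ mem_frustratedCounts_of_even_of_two_mul_le hy hny he hl) hk h1 h2,
      ⟨m, hme, hle, hmem, habs⟩, n.choose 3 - m,
      (Nat.even_sub hle).2 (iff_of_true (even_choose_three he) hme), ?_⟩
    exact notMem_frustratedCounts_upper hle hmem habs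
  · refine ⟨20, by norm_num, 20 ^ 4, fun n hn ho ↦ ?_⟩
    obtain ⟨y, hy, hny, h6, h5⟩ := exists_fourth_root hn
    norm_num only [Nat.cast_ofNat] at hy
    rw [h6, h5]
    have hq : √((2 * n : ℕ) : ℝ) = √2 * y ^ 2 := by
      push_cast
      rw [Real.sqrt_mul (by norm_num), hny, show y ^ 4 = (y ^ 2) ^ 2 by ring,
        Real.sqrt_sq (by positivity)]
    have hs2 : 3 ≤ (2 * n).sqrt := Nat.le_sqrt.2 (by omega)
    have hsn : (2 * n).sqrt ≤ n := by
      rw [← Nat.lt_succ_iff, Nat.sqrt_lt]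
      nlinarith
    set m := ((2 * n).sqrt - 3) * (n - 2) + 2 with hm
    have hmem : m ∉ frustratedCounts n := sqrt_sub_three_notMem_frustratedCounts (by omega) ho
    have hle : m ≤ n.choose 3 := mul_add_two_le_choose_three (by omega)
      ((Nat.sub_le _ _).trans hsn)
    have habs : |(m : ℝ) - √2 * y ^ 6| ≤ 20 * y ^ 5 := by
      have := abs_gap_sub_le (c := √2) (s := (2 * n).sqrt) (j := 3) (by positivity)
        (Real.sqrt_le_iff.2 (by norm_num)) hy (hq ▸ Real.nat_sqrt_le_real_sqrt)
        (hq ▸ Real.real_sqrt_le_nat_sqrt_succ) (by norm_num) le_rfl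
      rw [hm]
      push_cast [Nat.cast_sub hs2, Nat.cast_sub (show 2 ≤ n by omega)]
      rwa [hny]
    refine ⟨fun k h1 h2 ↦ mem_frustratedCounts_of_lower_half (P := fun _ ↦ True) (by positivity)
      (fun _ _ _ ↦ trivial)
      (fun l _ ↦ mem_frustratedCounts_of_odd_of_two_mul_le hy hny ho) trivial h1 h2,
      ⟨m, hle, hmem, habs⟩, n.choose 3 - m, ?_⟩
    exact notMem_frustratedCounts_upper hle hmem habs
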